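/- Setting. Fix an integer $I\ge 1$, service rates $\mu_1,\dots,\mu_I>0$ and a constant $\epsilon_0\in(0,1)$. For each $n$ consider a multiserver-job system with $n$ servers and $I$ job types: type $i$ jobs arrive according to a Poisson process of rate $\lambda_i=\lambda_i^{(n)}>0$, each of them occupies $\ell_i=\ell_i^{(n)}\in\{1,2,\dots\}$ servers while in service and needs an exponentially distributed service time of rate $\mu_i$; arrivals and service times are independent, and preemption is allowed. Let $\ell_{\max}=\max_i\ell_i$, $\delta=n-\sum_{i=1}^I\lambda_i\ell_i/\mu_i$ and $\bar x_i=\lambda_i/\mu_i$. Under a (Markovian) scheduling policy the system is a continuous-time Markov chain on a countable state space with bounded transition rates; $X_i(t)$ and $Z_i(t)$ denote the numbers of type $i$ jobs in the system and in service at time $t$, so $Z_i\le X_i$ and $\sum_i\ell_iZ_i\le n$, and $X_i(\infty)$ denotes $X_i$ under a stationary distribution of the chain. A policy is called $w$-work-conserving if $\sum_i\ell_iZ_i(t)\ge\min\bigl(\sum_i\ell_iX_i(t),\,n-w\bigr)$ at all times. Lemma (total server need upper bound under lighter traffic). There is a constant $c>0$, depending only on $I$, $\mu_1,\dots,\mu_I$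 and $\epsilon_0$, with the following property. Suppose that $\ell_{\max}\le\epsilon_0\delta$ for all large $n$ and $\delta=\omega(\sqrt{n\ell_{\max}}\log n)$ as $n\to\infty$. Then for all sufficiently large $n$, for every $\ell_{\max}$-work-conserving policy and every stationary distribution of the resulting Markov chain, the expectation below is finite and $$0<\mathbb E\Bigl[\sum_{i=1}^I\ell_i\bigl(X_i(\infty)-\bar x_i\bigr)\Bigr]\le\exp\Bigl(-c\,\frac{\delta^2}{n\ell_{\max}}\Bigr),$$ that is, $\mathbb E\bigl[\sum_i\ell_i(X_i(\infty)-\bar x_i)\bigr]=\exp\bigl(-\Omega(\delta^2/(n\ell_{\max}))\bigr)$, uniformly over the policies. In particular, for every $k\in\mathbb N$, $n^k$ times this expectation tends to $0$ as $n\to\infty$, uniformly over the policies and stationary distributions. -/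

import Mathlib

open Filter Asymptotics

open scoped ENNReal NNReal

noncomputable section

namespace MultiserverJob

/-- The maximal server need `ℓ_max = max_i ℓ_i`. -/
def maxNeed {I : ℕ} (need : Fin I → ℕ) : ℕ := Finset.univ.sup need

/-- The slack capacity `δ = n - ∑ i, λ_i ℓ_i / μ_i`. -/
def slack {I : ℕ} (n : ℕ) (arr srv : Fin I → ℝ) (need : Fin I → ℕ) : ℝ :=
  (n : ℝ) - ∑ i, arr i * (need i : ℝ) / srv i

/-- A (possibly preemptive, possibly randomized) Markovian scheduling policy for a system with `n`
servers and `I` job types, in which a type `i` job occupies `need i` servers while in service.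

`State` is the countable set of system states (for instance ordered lists of jobs, each with its
type and a flag telling whether it is in service). In state `s` there are `X s i` jobs of type `i`
in the system, `Z s i` of which are in service. When a type `i` job arrives, resp. when a type `i`
job in service is completed, the next state has law `onArrival s i`, resp. `onDeparture s i`. The
policy may moreover revise its schedule between these events, at the ticks of an auxiliary Poisson
clock of rate `clockRate` (which may be `0`); no job enters or leaves at a tick.
The law `onDeparture s i` is irrelevant when `Z s i = 0`. -/
structure Policy (I n : ℕ) (need : Fin I → ℕ) where
  State : Type
  countable_state : Countable State
  X : State → Fin I → ℕ
  Z : State → Fin I → ℕ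
  Z_le_X : ∀ s i, Z s i ≤ X s i
  capacity : ∀ s, ∑ i, need i * Z s i ≤ n
  onArrival : State → Fin I → PMF State
  onDeparture : State → Fin I → PMF State
  clockRate : ℝ≥0
  onTick : State → PMF State
  X_onArrival : ∀ s i, ∀ s' ∈ (onArrival s i).support, X s' = X s + Pi.single i 1
  X_onDeparture : ∀ s i, 0 < Z s i →
    ∀ s' ∈ (onDeparture s i).support, X s' + Pi.single i 1 = X s
  X_onTick : ∀ s, ∀ s' ∈ (onTick s).support, X s' = X s

namespace Policy

variable {I n : ℕ} {need : Fin I → ℕ}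

/-- A policy is `w`-work-conserving if in every state at least
`min (∑ i, ℓ_i X_i) (n - w)` servers are busy. -/
def WorkConserving (P : Policy I n need) (w : ℝ) : Prop :=
  ∀ s : P.State, min (∑ i, (need i : ℝ) * (P.X s i : ℝ)) ((n : ℝ) - w)
    ≤ ∑ i, (need i : ℝ) * (P.Z s i : ℝ)

/-- Transition rates of the continuous-time Markov chain of the system: type `i` jobs arrive in a
Poisson process of rate `arr i`, and each type `i` job in service is completed at rate `srv i`. -/
def rate (P : Policy I n need) (arr srv : Fin I → ℝ) (s s' : P.State) : ℝ≥0∞ :=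
  (∑ i, ENNReal.ofReal (arr i) * P.onArrival s i s')
    + (∑ i, ENNReal.ofReal (srv i) * (P.Z s i : ℝ≥0∞) * P.onDeparture s i s')
    + (P.clockRate : ℝ≥0∞) * P.onTick s s'

/-- `π` is a stationary distribution of the continuous-time Markov chain of the system: it solves
the global balance equations (the total transition rate out of a state is bounded over all states).
The possible self-transitions contribute the same finite amount to both sides. -/
def IsStationary (P : Policy I n need) (arr srv : Fin I → ℝ) (π : PMF P.State) : Prop :=
  ∀ s' : P.State,
    ∑' s, π s * P.rate arr srv s s' = π s' * ∑' s, P.rate arr srv s' s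

/-- The quantity `∑ i, ℓ_i (X_i - λ_i / μ_i)` in state `s`. -/
def excessNeed (P : Policy I n need) (arr srv : Fin I → ℝ) (s : P.State) : ℝ :=
  ∑ i, (need i : ℝ) * ((P.X s i : ℝ) - arr i / srv i)

/-- The steady-state expectation `E[∑ i, ℓ_i (X_i(∞) - λ_i / μ_i)]`, when the state of the system
has law `π`. -/
def expectedExcessNeed (P : Policy I n need) (arr srv : Fin I → ℝ) (π : PMF P.State) : ℝ :=
  ∑' s, (π s).toReal * P.excessNeed arr srv s

end Policy

end MultiserverJob

end

/-! In steady state the mean number of type `i` jobs in service is `λ_i / μ_i`, so the mean excess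
need equals the mean of `Q = ∑ i, ℓ_i (X_i - Z_i)`, the need of the waiting jobs. It is positive
because `X_i` exceeds `n` with positive probability. It is tiny because `Q > 0` forces at least `n -
ℓ_max` busy servers, hence a total need exceeding its load by at least the order of `δ`, and such
states are exponentially rare.

Rarity comes from the Lyapunov function `F = ∑ i, (ℓ_i / μ_i) (x_i - λ_i / μ_i)⁺`. If at least `n -
ℓ_max` servers are busy, total work decreases at rate at least `δ - ℓ_max`; types below their mean
only help, since `z ≤ x`. If every job is served, each type relaxes to its mean and the drift is
about `-m F` with `m = min μ_i`. So the drift is at most `-K δ` once `F` exceeds `β δ`.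

The kink of the positive part would spoil the drift estimate, so it is rounded on a window of width
`w`, as `softPos w`. Rounding costs at most `w ∑ ℓ_i` in the drift, and the slope becomes `1 /
w`-Lipschitz, which controls second-order errors. With `w` of order `δ / ℓ_max` and `θ` of order `δ
/ (n ℓ_max)`, `exp_softWork_drift` gives `E exp (θ F) ≤ 4 exp (θ β δ)`. Waiting requires `F ≥ 4 β δ`
and `Q ≤ M F` with `M = max μ_i`, so `E Q ≤ (8 M / θ) exp (-θ β δ)`, where `θ β δ` is of order `δ² /
(n ℓ_max)`. This ratio eventually exceeds `log² n`, so half of the exponent absorbs the polynomial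
prefactor. -/

namespace MultiserverJob

/-! ### The smoothed positive part -/

/-- A continuously differentiable convex surrogate of the positive part: it vanishes on `(-∞, -w]`,
equals `y + w / 2` on `[0, ∞)`, and its derivative is `softStep w`. -/
noncomputable def softPos (w y : ℝ) : ℝ :=
  if y ≤ -w then 0 else if y ≤ 0 then (y + w) ^ 2 / (2 * w) else y + w / 2

/-- The derivative of `softPos w`. -/
noncomputable def softStep (w y : ℝ) : ℝ :=
  if y ≤ -w then 0 else if y ≤ 0 then (y + w) / w else 1

section softPos

variable {w : ℝ} (hw : 0 < w)
include hw

theorem softStep_nonneg (y : ℝ) : 0 ≤ softStep w y := by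
  unfold softStep
  split_ifs with h1 h2
  · exact le_rfl
  · have : 0 ≤ y + w := by linarith
    positivity
  · exact zero_le_one

theorem softStep_le_one (y : ℝ) : softStep w y ≤ 1 := by
  unfold softStep
  split_ifs with h1 h2
  · exact zero_le_one
  · rw [div_le_one hw]; linarith
  · exact le_rfl

theorem softStep_of_nonneg {y : ℝ} (hy : 0 ≤ y) : softStep w y = 1 := by
  unfold softStep
  rw [if_neg (by linarith)]
  split_ifs with h2
  · rw [le_antisymm h2 hy, zero_add, div_self hw.ne']
  · rfl

/-- The slope itself is the maximizer in the variational formula of `le_softPos_of_mem`. Testing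
that formula at one point with the slope of another yields the Lipschitz and second-order bounds
below. -/
theorem softPos_eq (y : ℝ) :
    softPos w y = softStep w y * (y + w) - w / 2 * softStep w y ^ 2 := by
  unfold softPos softStep
  split_ifs with h1 h2
  · ring
  · field_simp; ring
  · ring

/-- `softPos w y` is the maximum of `s (y + w) - w s² / 2` over `s ∈ [0, 1]`. -/
theorem le_softPos_of_mem {s : ℝ} (h0 : 0 ≤ s) (h1 : s ≤ 1) (y : ℝ) :
    s * (y + w) - w / 2 * s ^ 2 ≤ softPos w y := by
  unfold softPos
  split_ifs with h2 h3
  · nlinarith [mul_nonneg h0 (by linarith : 0 ≤ -(y + w)), mul_nonneg hw.le (sq_nonneg s)]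
  · rw [le_div_iff₀ (by positivity)]
    nlinarith [sq_nonneg (y + w - w * s)]
  · nlinarith [mul_nonneg (by linarith : 0 ≤ 1 - s) (by linarith : 0 ≤ y),
      mul_nonneg hw.le (sq_nonneg (1 - s))]

theorem softPos_nonneg (y : ℝ) : 0 ≤ softPos w y := by
  simpa using le_softPos_of_mem hw le_rfl zero_le_one y

theorem le_softPos (y : ℝ) : y ≤ softPos w y := by
  have := le_softPos_of_mem hw zero_le_one le_rfl y
  linarith

theorem softPos_sub_le_mul_softStep (y : ℝ) : softPos w y - w ≤ y * softStep w y := by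
  rw [softPos_eq hw]
  have h0 := softStep_nonneg hw y
  have h1 := softStep_le_one hw y
  nlinarith [mul_nonneg hw.le (sq_nonneg (softStep w y))]

/-- `softPos` is `1`-Lipschitz and nondecreasing. -/
theorem abs_softPos_sub_le (y z : ℝ) : |softPos w z - softPos w y| ≤ |z - y| := by
  have key : ∀ y z : ℝ, softPos w z - softPos w y ≤ |z - y| := fun y z => by
    have h := le_softPos_of_mem hw (softStep_nonneg hw z) (softStep_le_one hw z) y
    rw [softPos_eq hw z]
    calc _ ≤ softStep w z * (z - y) := by linarith
      _ ≤ softStep w z * |z - y| :=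
        mul_le_mul_of_nonneg_left (le_abs_self _) (softStep_nonneg hw z)
      _ ≤ |z - y| := mul_le_of_le_one_left (abs_nonneg _) (softStep_le_one hw z)
  rw [abs_le]
  constructor
  · have := key z y
    rw [abs_sub_comm] at this
    linarith
  · exact key y z

theorem abs_softStep_sub_le (y z : ℝ) : |softStep w z - softStep w y| ≤ |z - y| / w := by
  have key : ∀ y z : ℝ, y ≤ z →
      0 ≤ softStep w z - softStep w y ∧ softStep w z - softStep w y ≤ (z - y) / w := by
    intro y z h
    unfold softStep
    rw [le_div_iff₀ hw]
    split_ifs <;> (try constructor) <;> field_simp <;> linarith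
  rcases le_total y z with h | h
  · obtain ⟨h1, h2⟩ := key y z h
    rwa [abs_of_nonneg h1, abs_of_nonneg (by linarith)]
  · obtain ⟨h1, h2⟩ := key z y h
    rwa [abs_sub_comm, abs_sub_comm z, abs_of_nonneg h1, abs_of_nonneg (by linarith)]

/-- By convexity the increment is at most `h` times the slope at the endpoint `y + h`; the Lipschitz
bound on the slope moves it back to `y`. -/
theorem softPos_add_le (y h : ℝ) :
    softPos w (y + h) ≤ softPos w y + softStep w y * h + h ^ 2 / w := by
  have h1 := le_softPos_of_mem hw (softStep_nonneg hw (y + h)) (softStep_le_one hw (y + h)) y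
  have h2 : (softStep w (y + h) - softStep w y) * h ≤ h ^ 2 / w := by
    calc _ ≤ |softStep w (y + h) - softStep w y| * |h| := by
          rw [← abs_mul]; exact le_abs_self _
      _ ≤ |y + h - y| / w * |h| :=
          mul_le_mul_of_nonneg_right (abs_softStep_sub_le hw _ _) (abs_nonneg _)
      _ = h ^ 2 / w := by rw [add_sub_cancel_left, div_mul_eq_mul_div, abs_mul_abs_self, sq]
  rw [softPos_eq hw (y + h)]
  linarith

end softPos

/-! ### Stationary distributions of jump chains with bounded rates -/

section Stationary

variable {S : Type*} {π : PMF S} {r : S → S → ℝ≥0∞}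

/-- Integrated form of the global balance equations. -/
theorem tsum_balance (hbal : ∀ s', ∑' s, π s * r s s' = π s' * ∑' s, r s' s) (h : S → ℝ≥0∞) :
    ∑' s, π s * ∑' s', r s s' * h s' = ∑' s, π s * ((∑' s', r s s') * h s) := by
  calc ∑' s, π s * ∑' s', r s s' * h s' = ∑' s, ∑' s', π s * r s s' * h s' := by
        simp_rw [← ENNReal.tsum_mul_left, mul_assoc]
    _ = ∑' s', ∑' s, π s * r s s' * h s' := ENNReal.tsum_comm
    _ = ∑' s', (∑' s, π s * r s s') * h s' := by simp_rw [ENNReal.tsum_mul_right]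
    _ = _ := by simp_rw [hbal, mul_assoc]

/-- The Foster–Lyapunov bound for stationary distributions of chains with bounded rates. -/
theorem mul_tsum_le_of_drift
    (hbal : ∀ s', ∑' s, π s * r s s' = π s' * ∑' s, r s' s)
    {B : ℝ≥0∞} (hB : B ≠ ∞) (hr : ∀ s, ∑' s', r s s' ≤ B)
    {v : S → ℝ≥0∞} (hv : ∀ s, v s ≠ ∞) {a b : ℝ≥0∞}
    (hdrift : ∀ s, ∑' s', r s s' * v s' + a * v s ≤ (∑' s', r s s') * v s + b) :
    a * ∑' s, π s * v s ≤ b := by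
  -- Testing stationarity on the bounded function `min v M` keeps both sides finite, so they cancel.
  -- Where `v s > M` the truncated function is already maximal, and its drift is nonpositive without
  -- any hypothesis.
  have htrunc : ∀ M : ℝ≥0∞, M ≠ ∞ → a * ∑' s, π s * (if v s ≤ M then v s else 0) ≤ b := by
    intro M hM
    have hpt : ∀ s, ∑' s', r s s' * min (v s') M + a * (if v s ≤ M then v s else 0)
        ≤ (∑' s', r s s') * min (v s) M + b := by
      intro s
      split_ifs with h
      · rw [min_eq_left h]
        refine le_trans ?_ (hdrift s)
        gcongr
        exact min_le_left _ _
      · rw [min_eq_right (not_le.1 h).le, mul_zero, add_zero, ← ENNReal.tsum_mul_right]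
        refine le_trans ?_ le_self_add
        gcongr
        exact min_le_right _ _
    have hsum := ENNReal.tsum_le_tsum fun s => mul_le_mul_right (hpt s) (π s)
    simp_rw [mul_add, ENNReal.tsum_add] at hsum
    rw [tsum_balance hbal, ENNReal.tsum_mul_right, π.tsum_coe, one_mul] at hsum
    have hfin : ∑' s, π s * ((∑' s', r s s') * min (v s) M) ≠ ∞ := by
      refine ne_top_of_le_ne_top (b := B * M) (ENNReal.mul_ne_top hB hM) ?_
      calc _ ≤ ∑' s, π s * (B * M) := by
            gcongr with s
            · exact hr s
            · exact min_le_right _ _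
        _ = B * M := by rw [ENNReal.tsum_mul_right, π.tsum_coe, one_mul]
    have := (ENNReal.add_le_add_iff_left hfin).1 hsum
    calc _ = ∑' s, π s * (a * (if v s ≤ M then v s else 0)) := by
          rw [← ENNReal.tsum_mul_left]
          exact tsum_congr fun s => mul_left_comm _ _ _
      _ ≤ b := this
  rw [ENNReal.tsum_eq_iSup_sum, ENNReal.mul_iSup]
  refine iSup_le fun t => ?_
  -- On a finite set of states, truncation at the largest value of `v` changes nothing.
  refine le_trans ?_ (htrunc (t.sup v) ?_)
  · gcongr
    refine le_trans (le_of_eq ?_) (ENNReal.sum_le_tsum t)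
    refine Finset.sum_congr rfl fun s hs => ?_
    rw [if_pos (Finset.le_sup hs)]
  · exact ((Finset.sup_lt_iff (by simp)).2 fun s _ => (hv s).lt_top).ne

end Stationary

theorem _root_.PMF.tsum_mul_eq_of_forall_support {α : Type*} (p : PMF α) {f : α → ℝ≥0∞}
    {c : ℝ≥0∞} (h : ∀ a ∈ p.support, f a = c) : ∑' a, p a * f a = c := by
  calc ∑' a, p a * f a = ∑' a, p a * c := by
        refine tsum_congr fun a => ?_
        by_cases ha : p a = 0
        · simp [ha]
        · rw [h a ((p.mem_support_iff a).2 ha)]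
    _ = c := by rw [ENNReal.tsum_mul_right, p.tsum_coe, one_mul]

/-! ### The generator on functions of the queue lengths, and rate conservation -/

namespace Policy

variable {I n : ℕ} {need : Fin I → ℕ} (P : Policy I n need) (arr srv : Fin I → ℝ)

/-- Each event changes `X` deterministically, so the randomization in the policy disappears on
functions of `X`. -/
theorem tsum_rate_mul (g : (Fin I → ℕ) → ℝ≥0∞) (s : P.State) :
    ∑' s', P.rate arr srv s s' * g (P.X s') =
      (∑ i, ENNReal.ofReal (arr i) * g (P.X s + Pi.single i 1))
        + (∑ i, ENNReal.ofReal (srv i) * (P.Z s i : ℝ≥0∞) * g (P.X s - Pi.single i 1))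
        + (P.clockRate : ℝ≥0∞) * g (P.X s) := by
  simp_rw [rate, add_mul, Finset.sum_mul, ENNReal.tsum_add]
  rw [Summable.tsum_finsetSum fun _ _ => ENNReal.summable,
    Summable.tsum_finsetSum fun _ _ => ENNReal.summable]
  simp_rw [mul_assoc, ENNReal.tsum_mul_left]
  congr 2
  · refine Finset.sum_congr rfl fun i _ => ?_
    rw [PMF.tsum_mul_eq_of_forall_support _ fun s' hs' => by rw [P.X_onArrival s i s' hs']]
  · refine Finset.sum_congr rfl fun i _ => ?_
    rcases Nat.eq_zero_or_pos (P.Z s i) with h | h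
    · simp [h]
    · rw [PMF.tsum_mul_eq_of_forall_support _ fun s' hs' => by
        rw [eq_tsub_of_add_eq (P.X_onDeparture s i h s' hs')]]
  · rw [PMF.tsum_mul_eq_of_forall_support _ fun s' hs' => by rw [P.X_onTick s s' hs']]

theorem tsum_rate (s : P.State) :
    ∑' s', P.rate arr srv s s' = (∑ i, ENNReal.ofReal (arr i))
        + (∑ i, ENNReal.ofReal (srv i) * (P.Z s i : ℝ≥0∞)) + (P.clockRate : ℝ≥0∞) := by
  simpa using P.tsum_rate_mul arr srv (fun _ => 1) s

variable {P} in
theorem Z_le (hneed : ∀ i, 0 < need i) (s : P.State) (i : Fin I) : P.Z s i ≤ n :=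
  calc P.Z s i ≤ need i * P.Z s i := Nat.le_mul_of_pos_left _ (hneed i)
    _ ≤ ∑ j, need j * P.Z s j :=
      Finset.single_le_sum (f := fun j => need j * P.Z s j) (fun _ _ => Nat.zero_le _)
        (Finset.mem_univ i)
    _ ≤ n := P.capacity s

theorem exists_rate_bound (hneed : ∀ i, 0 < need i) :
    ∃ B : ℝ≥0∞, B ≠ ∞ ∧ ∀ s, ∑' s', P.rate arr srv s s' ≤ B := by
  refine ⟨(∑ i, ENNReal.ofReal (arr i)) + (∑ i, ENNReal.ofReal (srv i) * (n : ℝ≥0∞))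
    + (P.clockRate : ℝ≥0∞), ?_, fun s => ?_⟩
  · simp [ENNReal.sum_eq_top, ENNReal.mul_eq_top]
  · rw [tsum_rate]
    gcongr with i
    exact Z_le hneed s i

variable {P arr srv} {π : PMF P.State}

/-- In steady state the mean number of type `i` jobs in service is `λ_i / μ_i`. -/
theorem IsStationary.tsum_Z (hπ : P.IsStationary arr srv π) (hneed : ∀ i, 0 < need i)
    (i : Fin I) (hX : ∑' s, π s * (P.X s i : ℝ≥0∞) ≠ ∞) :
    ENNReal.ofReal (srv i) * ∑' s, π s * (P.Z s i : ℝ≥0∞) = ENNReal.ofReal (arr i) := by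
  obtain ⟨B, hB, hrB⟩ := P.exists_rate_bound arr srv hneed
  have hpt : ∀ s, ∑' s', P.rate arr srv s s' * (P.X s' i : ℝ≥0∞)
      + ENNReal.ofReal (srv i) * (P.Z s i : ℝ≥0∞)
      = (∑' s', P.rate arr srv s s') * (P.X s i : ℝ≥0∞) + ENNReal.ofReal (arr i) := by
    intro s
    rw [P.tsum_rate_mul arr srv (fun x => (x i : ℝ≥0∞)) s, tsum_rate, add_mul, add_mul,
      Finset.sum_mul, Finset.sum_mul]
    have h1 : ∑ j, ENNReal.ofReal (arr j) * (((P.X s + Pi.single j 1 : Fin I → ℕ) i : ℕ) : ℝ≥0∞)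
        = ∑ j, ENNReal.ofReal (arr j) * (P.X s i : ℝ≥0∞) + ENNReal.ofReal (arr i) := by
      simp only [Pi.add_apply, Nat.cast_add, mul_add, Finset.sum_add_distrib]
      congr 1
      rw [Finset.sum_eq_single i]
      · simp
      · intro j _ hj; simp [hj.symm]
      · simp
    have h2 : ∑ j, ENNReal.ofReal (srv j) * (P.Z s j : ℝ≥0∞) * (((P.X s - Pi.single j 1 : Fin I → ℕ) i : ℕ) : ℝ≥0∞)
        + ENNReal.ofReal (srv i) * (P.Z s i : ℝ≥0∞)
        = ∑ j, ENNReal.ofReal (srv j) * (P.Z s j : ℝ≥0∞) * (P.X s i : ℝ≥0∞) := by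
      rw [← Finset.add_sum_erase _ _ (Finset.mem_univ i),
        ← Finset.add_sum_erase _ (fun j => _ * (P.X s i : ℝ≥0∞)) (Finset.mem_univ i),
        add_right_comm]
      congr 1
      · rcases Nat.eq_zero_or_pos (P.Z s i) with h | h
        · simp [h]
        · have hx : 1 ≤ P.X s i := h.trans_le (P.Z_le_X s i)
          rw [Pi.sub_apply, Pi.single_eq_same, ← mul_add_one]
          norm_cast
          rw [Nat.sub_add_cancel hx]
      · refine Finset.sum_congr rfl fun j hj => ?_
        rw [Pi.sub_apply, Pi.single_eq_of_ne (Finset.ne_of_mem_erase hj).symm, Nat.sub_zero]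
    rw [h1, ← h2]
    ring
  have hsum : ∑' s, π s * (∑' s', P.rate arr srv s s' * (P.X s' i : ℝ≥0∞)
      + ENNReal.ofReal (srv i) * (P.Z s i : ℝ≥0∞))
      = ∑' s, π s * ((∑' s', P.rate arr srv s s') * (P.X s i : ℝ≥0∞)
        + ENNReal.ofReal (arr i)) := tsum_congr fun s => by rw [hpt]
  simp_rw [mul_add, ENNReal.tsum_add] at hsum
  rw [tsum_balance hπ, ENNReal.tsum_mul_right, π.tsum_coe, one_mul] at hsum
  have hfin : ∑' s, π s * ((∑' s', P.rate arr srv s s') * (P.X s i : ℝ≥0∞)) ≠ ∞ := by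
    refine ne_top_of_le_ne_top (ENNReal.mul_ne_top hB hX) ?_
    rw [← ENNReal.tsum_mul_left]
    refine ENNReal.tsum_le_tsum fun s => ?_
    rw [mul_left_comm]
    gcongr
    exact hrB s
  rw [← (ENNReal.add_right_inj hfin).1 hsum, ← ENNReal.tsum_mul_left]
  exact tsum_congr fun s => mul_left_comm _ _ _

/-- Under a stationary distribution every number of type `i` jobs is exceeded with positive
probability. -/
theorem IsStationary.exists_le_X (hπ : P.IsStationary arr srv π)
    {i : Fin I} (harr : 0 < arr i) (k : ℕ) : ∃ s, π s ≠ 0 ∧ k ≤ P.X s i := by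
  induction k with
  | zero =>
    obtain ⟨s, hs⟩ := π.support_nonempty
    exact ⟨s, (π.mem_support_iff s).1 hs, Nat.zero_le _⟩
  | succ k ih =>
    obtain ⟨s, hs, hk⟩ := ih
    obtain ⟨s', hs'⟩ := (P.onArrival s i).support_nonempty
    refine ⟨s', fun h0 => ?_, ?_⟩
    -- If `π s'` vanished, balance would force zero inflow into `s'`, but `s` feeds it by an
    -- arrival.
    · have hz := hπ s'
      rw [h0, zero_mul, ENNReal.tsum_eq_zero] at hz
      have hr := (mul_eq_zero.1 (hz s)).resolve_left hs
      rw [rate, add_eq_zero, add_eq_zero, Finset.sum_eq_zero_iff] at hr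
      have := hr.1.1 i (Finset.mem_univ i)
      rcases mul_eq_zero.1 this with h | h
      · exact (ENNReal.ofReal_pos.2 harr).ne' h
      · exact ((PMF.mem_support_iff _ _).1 hs') h
    · rw [P.X_onArrival s i s' hs']
      simpa using hk

end Policy

/-! ### Drift estimates for the smoothed workload -/

section Drift

/-- The function `∑ i, (ℓ_i / μ_i) (x_i - λ_i / μ_i)⁺` with the positive part replaced by
`softPos w`. -/
noncomputable def softWork {I : ℕ} (arr srv : Fin I → ℝ) (need : Fin I → ℕ) (w : ℝ)
    (x : Fin I → ℕ) : ℝ :=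
  ∑ i, (need i : ℝ) / srv i * softPos w ((x i : ℝ) - arr i / srv i)

variable {I : ℕ} {arr srv : Fin I → ℝ} {need : Fin I → ℕ} {w : ℝ}

theorem softWork_nonneg (hw : 0 < w) (hsrv : ∀ i, 0 < srv i) (x : Fin I → ℕ) :
    0 ≤ softWork arr srv need w x :=
  Finset.sum_nonneg fun i _ =>
    mul_nonneg (div_nonneg (Nat.cast_nonneg _) (hsrv i).le) (softPos_nonneg hw _)

theorem softWork_of_eq_off {x x' : Fin I → ℕ} {i : Fin I} {h : ℝ}
    (hi : (x' i : ℝ) = x i + h) (hj : ∀ j, j ≠ i → x' j = x j) :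
    softWork arr srv need w x' = softWork arr srv need w x
      + (need i : ℝ) / srv i * (softPos w ((x i : ℝ) - arr i / srv i + h)
        - softPos w ((x i : ℝ) - arr i / srv i)) := by
  unfold softWork
  rw [← Finset.add_sum_erase _ _ (Finset.mem_univ i),
    ← Finset.add_sum_erase _ (fun j => (need j : ℝ) / srv j *
      softPos w ((x j : ℝ) - arr j / srv j)) (Finset.mem_univ i),
    Finset.sum_congr rfl fun j hj' => by rw [hj j (Finset.ne_of_mem_erase hj')], hi,
    add_sub_right_comm]
  ring

/-- Uses `exp u ≤ 1 + u + u²` for `|u| ≤ 1`: the term `1 / w` is the curvature error of `softPos`,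
and `q r` bounds the quadratic term `q²`. -/
theorem exp_softPos_jump_le (hw : 0 < w) {q r : ℝ} (hq : 0 ≤ q) (hq1 : q ≤ 1) (hqr : q ≤ r)
    (y : ℝ) {h : ℝ} (hh : |h| = 1) :
    Real.exp (q * (softPos w (y + h) - softPos w y))
      ≤ 1 + q * (softStep w y * h + 1 / w + r) := by
  set Δ := softPos w (y + h) - softPos w y with hΔ
  have h1 : |Δ| ≤ 1 := by
    have := abs_softPos_sub_le hw y (y + h)
    rwa [add_sub_cancel_left, hh] at this
  have h2 : Δ ≤ softStep w y * h + 1 / w := by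
    have := softPos_add_le hw y h
    rw [← sq_abs h, hh, one_pow] at this
    linarith
  have h3 : |q * Δ| ≤ q := by
    rw [abs_mul, abs_of_nonneg hq]
    exact mul_le_of_le_one_right hq h1
  have h4 := (abs_le.1 (Real.abs_exp_sub_one_sub_id_le (h3.trans hq1))).2
  have h5 : (q * Δ) ^ 2 ≤ q ^ 2 := sq_le_sq' (abs_le.1 h3).1 (abs_le.1 h3).2
  nlinarith [mul_le_mul_of_nonneg_left h2 hq, mul_le_mul_of_nonneg_left hqr hq]

/-- The error `1 / w + r` per jump is weighted by `ℓ_i / μ_i` times the jump rate. Arrivals then sum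
to the load and departures to the number of busy servers, each at most `N`; hence the factor `2 *
N`. -/
theorem sum_exp_softWork_le (hw : 0 < w) (harr : ∀ i, 0 ≤ arr i) (hsrv : ∀ i, 0 < srv i)
    {θ r N d : ℝ} (hθ : 0 ≤ θ) (hθr : ∀ i, θ * ((need i : ℝ) / srv i) ≤ r) (hr0 : 0 ≤ r) (hr : r ≤ 1)
    {x z : Fin I → ℕ} (hzx : ∀ i, z i ≤ x i) (hz : ∑ i, (need i : ℝ) * z i ≤ N)
    (hN : ∑ i, arr i * (need i : ℝ) / srv i ≤ N)
    (hd : ∑ i, (need i : ℝ) / srv i * ((arr i - srv i * z i)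
      * softStep w ((x i : ℝ) - arr i / srv i)) ≤ d) :
    ∑ i, arr i * Real.exp (θ * softWork arr srv need w (x + Pi.single i 1))
      + ∑ i, srv i * z i * Real.exp (θ * softWork arr srv need w (x - Pi.single i 1))
    ≤ (∑ i, arr i + ∑ i, srv i * z i + θ * (d + 2 * N * (1 / w + r)))
      * Real.exp (θ * softWork arr srv need w x) := by
  set E := Real.exp (θ * softWork arr srv need w x) with hE
  have hE0 : 0 < E := Real.exp_pos _
  set p : Fin I → ℝ := fun i => (need i : ℝ) / srv i with hp
  set st : Fin I → ℝ := fun i => softStep w ((x i : ℝ) - arr i / srv i) with hst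
  have hp0 : ∀ i, 0 ≤ p i := fun i => div_nonneg (Nat.cast_nonneg _) (hsrv i).le
  have hup : ∀ i, arr i * Real.exp (θ * softWork arr srv need w (x + Pi.single i 1))
      ≤ arr i * ((1 + θ * p i * (st i * 1 + 1 / w + r)) * E) := by
    intro i
    refine mul_le_mul_of_nonneg_left ?_ (harr i)
    rw [softWork_of_eq_off (x := x) (i := i) (h := 1) (by simp)
      (fun j hj => by simp [hj]), mul_add, Real.exp_add, mul_comm, ← mul_assoc θ]
    exact mul_le_mul_of_nonneg_right (exp_softPos_jump_le hw (mul_nonneg hθ (hp0 i))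
      ((hθr i).trans hr) (hθr i) _ (by simp)) hE0.le
  have hdown : ∀ i, srv i * z i * Real.exp (θ * softWork arr srv need w (x - Pi.single i 1))
      ≤ srv i * z i * ((1 + θ * p i * (st i * (-1) + 1 / w + r)) * E) := by
    intro i
    rcases Nat.eq_zero_or_pos (z i) with h0 | h0
    · simp [h0]
    refine mul_le_mul_of_nonneg_left ?_ (mul_nonneg (hsrv i).le (Nat.cast_nonneg _))
    have hx : 1 ≤ x i := h0.trans_le (hzx i)
    rw [softWork_of_eq_off (x := x) (i := i) (h := -1)
      (by rw [Pi.sub_apply, Pi.single_eq_same, Nat.cast_sub hx, Nat.cast_one, sub_eq_add_neg])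
      (fun j hj => by simp [hj]), mul_add, Real.exp_add, mul_comm, ← mul_assoc θ]
    exact mul_le_mul_of_nonneg_right (exp_softPos_jump_le hw (mul_nonneg hθ (hp0 i))
      ((hθr i).trans hr) (hθr i) _ (by simp)) hE0.le
  have hpN : ∑ i, p i * (arr i + srv i * z i) ≤ 2 * N := by
    have : ∑ i, p i * (arr i + srv i * z i)
        = ∑ i, arr i * (need i : ℝ) / srv i + ∑ i, (need i : ℝ) * z i := by
      rw [← Finset.sum_add_distrib]
      refine Finset.sum_congr rfl fun i _ => ?_
      have := (hsrv i).ne'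
      simp only [hp]
      field_simp
    linarith
  have hR : (∑ i, p i * (arr i + srv i * z i)) * (1 / w + r) ≤ 2 * N * (1 / w + r) :=
    mul_le_mul_of_nonneg_right hpN (by positivity)
  calc _ ≤ ∑ i, arr i * ((1 + θ * p i * (st i * 1 + 1 / w + r)) * E)
        + ∑ i, srv i * z i * ((1 + θ * p i * (st i * (-1) + 1 / w + r)) * E) :=
        add_le_add (Finset.sum_le_sum fun i _ => hup i) (Finset.sum_le_sum fun i _ => hdown i)
    _ = (∑ i, arr i + ∑ i, srv i * z i
        + θ * (∑ i, p i * ((arr i - srv i * z i) * st i)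
          + (∑ i, p i * (arr i + srv i * z i)) * (1 / w + r))) * E := by
        simp only [Finset.sum_mul, Finset.mul_sum, ← Finset.sum_add_distrib]
        refine Finset.sum_congr rfl fun i _ => ?_
        ring
    _ ≤ _ := by
        refine mul_le_mul_of_nonneg_right ?_ hE0.le
        have := mul_le_mul_of_nonneg_left (add_le_add hd hR) hθ
        linarith

/-- The drift of the workload bounds the drift of `softWork`, as `z ≤ x`. -/
theorem softDrift_le_sub (hw : 0 < w) (hsrv : ∀ i, 0 < srv i) {x z : Fin I → ℕ}
    (hzx : ∀ i, z i ≤ x i) :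
    ∑ i, (need i : ℝ) / srv i * ((arr i - srv i * z i)
      * softStep w ((x i : ℝ) - arr i / srv i))
    ≤ ∑ i, arr i * (need i : ℝ) / srv i - ∑ i, (need i : ℝ) * z i := by
  rw [← Finset.sum_sub_distrib]
  refine Finset.sum_le_sum fun i _ => ?_
  have hs := hsrv i
  have hz : (z i : ℝ) ≤ x i := Nat.cast_le.2 (hzx i)
  have key : (arr i - srv i * z i) * softStep w ((x i : ℝ) - arr i / srv i)
      ≤ arr i - srv i * z i := by
    -- Above the mean the slope is `1`. Below it, `z ≤ x` makes the drift of the type nonnegative,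
    -- and a slope at most `1` can only reduce it.
    rcases le_total 0 ((x i : ℝ) - arr i / srv i) with h | h
    · rw [softStep_of_nonneg hw h, mul_one]
    · refine mul_le_of_le_one_right ?_ (softStep_le_one hw _)
      have : (z i : ℝ) ≤ arr i / srv i := by linarith
      rw [le_div_iff₀ hs] at this
      linarith
  calc _ ≤ (need i : ℝ) / srv i * (arr i - srv i * z i) :=
        mul_le_mul_of_nonneg_left key (by positivity)
    _ = _ := by field_simp

/-- With `z = x` the drift of each type is `-μ_i y`, where `y` is its deviation from the mean;
`softPos_sub_le_mul_softStep` turns this into a linear restoring force at the cost of the smoothing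
width. -/
theorem softDrift_le_of_all_served (hw : 0 < w) (hsrv : ∀ i, 0 < srv i) {m : ℝ}
    (hm : ∀ i, m ≤ srv i) (x : Fin I → ℕ) :
    ∑ i, (need i : ℝ) / srv i * ((arr i - srv i * x i)
      * softStep w ((x i : ℝ) - arr i / srv i))
    ≤ w * ∑ i, (need i : ℝ) - m * softWork arr srv need w x := by
  rw [softWork, Finset.mul_sum, Finset.mul_sum, ← Finset.sum_sub_distrib]
  refine Finset.sum_le_sum fun i _ => ?_
  have hs := hsrv i
  set y := (x i : ℝ) - arr i / srv i with hy
  have h1 := softPos_sub_le_mul_softStep hw y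
  have h2 : arr i - srv i * x i = -(srv i * y) := by rw [hy]; field_simp; ring
  calc _ = -((need i : ℝ) * (y * softStep w y)) := by rw [h2]; field_simp
    _ ≤ -((need i : ℝ) * (softPos w y - w)) :=
      neg_le_neg (mul_le_mul_of_nonneg_left h1 (Nat.cast_nonneg _))
    _ = w * need i - srv i * ((need i : ℝ) / srv i * softPos w y) := by field_simp; ring
    _ ≤ _ := by
      refine sub_le_sub_left (mul_le_mul_of_nonneg_right (hm i) ?_) _
      exact mul_nonneg (by positivity) (softPos_nonneg hw _)

/-- `softWork` dominates the excess server need. -/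
theorem sum_need_sub_le_softWork (hw : 0 < w) (hsrv : ∀ i, 0 < srv i) {M : ℝ}
    (hM : ∀ i, srv i ≤ M) (x : Fin I → ℕ) :
    ∑ i, (need i : ℝ) * ((x i : ℝ) - arr i / srv i) ≤ M * softWork arr srv need w x := by
  rw [softWork, Finset.mul_sum]
  refine Finset.sum_le_sum fun i _ => ?_
  have hs := hsrv i
  set y := (x i : ℝ) - arr i / srv i
  calc (need i : ℝ) * y ≤ need i * softPos w y :=
        mul_le_mul_of_nonneg_left (le_softPos hw y) (Nat.cast_nonneg _)
    _ = srv i * ((need i : ℝ) / srv i * softPos w y) := by field_simp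
    _ ≤ _ := mul_le_mul_of_nonneg_right (hM i)
      (mul_nonneg (by positivity) (softPos_nonneg hw _))

end Drift

/-! ### The exponential Lyapunov function under work conservation -/

section Lyapunov

variable {I : ℕ} {arr srv : Fin I → ℝ} {need : Fin I → ℕ} {w : ℝ}

/-- Foster–Lyapunov drift condition for `exp (θ * softWork)` under a work-conserving policy. -/
theorem exp_softWork_drift (hw : 0 < w) (harr : ∀ i, 0 ≤ arr i) (hsrv : ∀ i, 0 < srv i)
    (hneed : ∀ i, 0 < need i) {m θ r N L δ K β : ℝ} (hm0 : 0 ≤ m) (hm : ∀ i, m ≤ srv i)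
    (hθ : 0 ≤ θ) (hθr : ∀ i, θ * ((need i : ℝ) / srv i) ≤ r) (hr0 : 0 ≤ r) (hr : r ≤ 1)
    (hδ : 0 ≤ δ) (hK : 0 ≤ K) (hload : ∑ i, arr i * (need i : ℝ) / srv i = N - δ)
    (hKL : K * δ ≤ δ - L) (hwK : w * ∑ i, (need i : ℝ) ≤ K * δ) (hβ : 2 * K ≤ m * β)
    (hsmall : 2 * N * (1 / w + r) ≤ K * δ / 2)
    {x z : Fin I → ℕ} (hzx : ∀ i, z i ≤ x i) (hz : ∑ i, (need i : ℝ) * z i ≤ N)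
    (hwc : min (∑ i, (need i : ℝ) * x i) (N - L) ≤ ∑ i, (need i : ℝ) * z i) :
    ∑ i, arr i * Real.exp (θ * softWork arr srv need w (x + Pi.single i 1))
      + ∑ i, srv i * z i * Real.exp (θ * softWork arr srv need w (x - Pi.single i 1))
      + θ * (K * δ / 2) * Real.exp (θ * softWork arr srv need w x)
    ≤ (∑ i, arr i + ∑ i, srv i * z i) * Real.exp (θ * softWork arr srv need w x)
      + θ * (2 * (K * δ)) * Real.exp (θ * (β * δ)) := by
  set F := softWork arr srv need w x with hF
  have hE : 0 < Real.exp (θ * F) := Real.exp_pos _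
  have hKδ : 0 ≤ K * δ := mul_nonneg hK hδ
  have hN : ∑ i, arr i * (need i : ℝ) / srv i ≤ N := by linarith
  obtain ⟨d, hd, hcase⟩ : ∃ d, ∑ i, (need i : ℝ) / srv i * ((arr i - srv i * z i)
      * softStep w ((x i : ℝ) - arr i / srv i)) ≤ d ∧
      (d ≤ -(K * δ) ∨ (d ≤ K * δ ∧ F ≤ β * δ)) := by
    -- Either all jobs are served, which forces `z = x` as all needs are positive, or at least `N -
    -- L` servers are busy.
    rcases min_le_iff.1 hwc with hall | hbusy
    · have hzx' : z = x := by
        have heq : ∀ i ∈ Finset.univ, (need i : ℝ) * z i = need i * x i :=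
          (Finset.sum_eq_sum_iff_of_le fun i _ =>
            mul_le_mul_of_nonneg_left (Nat.cast_le.2 (hzx i)) (Nat.cast_nonneg _)).1
            (le_antisymm (Finset.sum_le_sum fun i _ =>
              mul_le_mul_of_nonneg_left (Nat.cast_le.2 (hzx i)) (Nat.cast_nonneg _)) hall)
        funext i
        have := heq i (Finset.mem_univ i)
        exact_mod_cast mul_left_cancel₀ (Nat.cast_ne_zero.2 (hneed i).ne') this
      subst hzx'
      refine ⟨K * δ - m * F, (softDrift_le_of_all_served hw hsrv hm z).trans (by linarith), ?_⟩
      rcases le_total F (β * δ) with h | h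
      · exact Or.inr ⟨by nlinarith [mul_nonneg hm0 (softWork_nonneg (need := need) (arr := arr)
          hw hsrv z)], h⟩
      · left
        nlinarith [mul_le_mul_of_nonneg_left h hm0, mul_le_mul_of_nonneg_right hβ hδ]
    · exact ⟨L - δ, (softDrift_le_sub hw hsrv hzx).trans (by linarith), Or.inl (by linarith)⟩
  have h := sum_exp_softWork_le hw harr hsrv hθ hθr hr0 hr hzx hz hN hd
  rw [← hF] at h
  refine (add_le_add_left h _).trans ?_
  have hs : θ * (2 * N * (1 / w + r)) * Real.exp (θ * F)
      ≤ θ * (K * δ / 2) * Real.exp (θ * F) :=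
    mul_le_mul_of_nonneg_right (mul_le_mul_of_nonneg_left hsmall hθ) hE.le
  -- With drift `-K δ`, the error `K δ / 2` and the gain `K δ / 2` cancel it exactly. Otherwise the
  -- three terms sum to at most `2 K δ`, and `F ≤ β δ` bounds the exponential.
  rcases hcase with hc | ⟨hc, hFβ⟩
  · have h1 : θ * d * Real.exp (θ * F) ≤ θ * (-(K * δ)) * Real.exp (θ * F) :=
      mul_le_mul_of_nonneg_right (mul_le_mul_of_nonneg_left hc hθ) hE.le
    have h2 : 0 ≤ θ * (2 * (K * δ)) * Real.exp (θ * (β * δ)) := by positivity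
    linarith
  · have h1 : θ * d * Real.exp (θ * F) ≤ θ * (K * δ) * Real.exp (θ * F) :=
      mul_le_mul_of_nonneg_right (mul_le_mul_of_nonneg_left hc hθ) hE.le
    have h2 : θ * (2 * (K * δ)) * Real.exp (θ * F)
        ≤ θ * (2 * (K * δ)) * Real.exp (θ * (β * δ)) :=
      mul_le_mul_of_nonneg_left
        (Real.exp_le_exp.2 (mul_le_mul_of_nonneg_left hFβ hθ)) (by positivity)
    linarith

/-- If some job waits, then `softWork` is large. -/
theorem le_softWork_of_waiting (hw : 0 < w) (hsrv : ∀ i, 0 < srv i) {M N L δ : ℝ}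
    (hM : ∀ i, srv i ≤ M)
    (hload : ∑ i, arr i * (need i : ℝ) / srv i = N - δ) {x z : Fin I → ℕ}
    (hwc : min (∑ i, (need i : ℝ) * x i) (N - L) ≤ ∑ i, (need i : ℝ) * z i)
    (hwait : ∑ i, (need i : ℝ) * z i < ∑ i, (need i : ℝ) * x i) :
    ∑ i, (need i : ℝ) * x i - ∑ i, (need i : ℝ) * z i + (δ - L)
      ≤ M * softWork arr srv need w x := by
  have hb : N - L ≤ ∑ i, (need i : ℝ) * z i :=
    (min_le_iff.1 hwc).resolve_left (not_le.2 hwait)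
  refine le_trans ?_ (sum_need_sub_le_softWork hw hsrv hM x)
  have : ∑ i, (need i : ℝ) * ((x i : ℝ) - arr i / srv i)
      = ∑ i, (need i : ℝ) * x i - ∑ i, arr i * (need i : ℝ) / srv i := by
    rw [← Finset.sum_sub_distrib]
    exact Finset.sum_congr rfl fun i _ => by ring
  rw [this, hload]
  linarith

end Lyapunov

/-! ### Real-valued stationary means: excess need as waiting need -/

theorem _root_.PMF.summable_and_tsum_le_of_tsum_ofReal_le {α : Type*} (p : PMF α) {g : α → ℝ}
    (hg : ∀ a, 0 ≤ g a) {C : ℝ} (hC : 0 ≤ C)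
    (h : ∑' a, p a * ENNReal.ofReal (g a) ≤ ENNReal.ofReal C) :
    Summable (fun a => (p a).toReal * g a) ∧ ∑' a, (p a).toReal * g a ≤ C := by
  have heq : (fun a => (p a).toReal * g a) = fun a => (p a * ENNReal.ofReal (g a)).toReal := by
    funext a
    rw [ENNReal.toReal_mul, ENNReal.toReal_ofReal (hg a)]
  rw [heq]
  refine ⟨ENNReal.summable_toReal (ne_top_of_le_ne_top ENNReal.ofReal_ne_top h), ?_⟩
  rw [← ENNReal.tsum_toReal_eq fun a => ENNReal.mul_ne_top (p.apply_ne_top a)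
    ENNReal.ofReal_ne_top]
  exact ENNReal.toReal_le_of_le_ofReal hC h

namespace Policy

variable {I n : ℕ} {need : Fin I → ℕ} {P : Policy I n need} {arr srv : Fin I → ℝ}
  {π : PMF P.State}

theorem IsStationary.hasSum_Z (hπ : P.IsStationary arr srv π) (hneed : ∀ i, 0 < need i)
    {i : Fin I} (harr : 0 ≤ arr i) (hsrv : 0 < srv i)
    (hX : Summable fun s => (π s).toReal * (P.X s i : ℝ)) :
    HasSum (fun s => (π s).toReal * (P.Z s i : ℝ)) (arr i / srv i) := by
  have hfin : ∀ f : P.State → ℕ, ∀ s, π s * (f s : ℝ≥0∞) ≠ ∞ := fun f s =>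
    ENNReal.mul_ne_top (π.apply_ne_top s) (ENNReal.natCast_ne_top _)
  have hXtop : ∑' s, π s * (P.X s i : ℝ≥0∞) ≠ ∞ := by
    have hcongr : ∀ s, π s * (P.X s i : ℝ≥0∞)
        = ENNReal.ofReal ((π s).toReal * (P.X s i : ℝ)) := fun s => by
      rw [ENNReal.ofReal_mul ENNReal.toReal_nonneg, ENNReal.ofReal_toReal (π.apply_ne_top s),
        ENNReal.ofReal_natCast]
    simp_rw [hcongr]
    exact hX.tsum_ofReal_ne_top
  have h := hπ.tsum_Z hneed i hXtop
  have hZtop : ∑' s, π s * (P.Z s i : ℝ≥0∞) ≠ ∞ := by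
    refine ne_top_of_le_ne_top hXtop (ENNReal.tsum_le_tsum fun s => ?_)
    gcongr
    exact P.Z_le_X s i
  have hreal : (∑' s, π s * (P.Z s i : ℝ≥0∞)).toReal = arr i / srv i := by
    have := congrArg ENNReal.toReal h
    rw [ENNReal.toReal_mul, ENNReal.toReal_ofReal hsrv.le, ENNReal.toReal_ofReal harr] at this
    rw [← this]
    field_simp
  have hs := ENNReal.hasSum_toReal hZtop
  rw [← ENNReal.tsum_toReal_eq (hfin _), hreal] at hs
  simpa only [ENNReal.toReal_mul, ENNReal.toReal_natCast] using hs

theorem _root_.PMF.hasSum_toReal_one {α : Type*} (p : PMF α) :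
    HasSum (fun a => (p a).toReal) 1 := by
  have h := ENNReal.hasSum_toReal (f := p) (by rw [p.tsum_coe]; exact ENNReal.one_ne_top)
  rwa [← ENNReal.tsum_toReal_eq p.apply_ne_top, p.tsum_coe, ENNReal.toReal_one] at h

/-- The mean excess server need is the mean server need of the waiting jobs. -/
theorem IsStationary.hasSum_excessNeed (hπ : P.IsStationary arr srv π) (hneed : ∀ i, 0 < need i)
    (harr : ∀ i, 0 ≤ arr i) (hsrv : ∀ i, 0 < srv i)
    (hX : ∀ i, Summable fun s => (π s).toReal * (P.X s i : ℝ)) :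
    HasSum (fun s => (π s).toReal * P.excessNeed arr srv s)
      (∑' s, (π s).toReal
        * (∑ i, (need i : ℝ) * P.X s i - ∑ i, (need i : ℝ) * P.Z s i)) := by
  have hZ := fun i => hπ.hasSum_Z hneed (harr i) (hsrv i) (hX i)
  have h0 : HasSum (fun s => ∑ i, (need i : ℝ)
      * ((π s).toReal * (P.Z s i : ℝ) - (π s).toReal * (arr i / srv i))) 0 := by
    have := hasSum_sum (s := Finset.univ) fun i _ =>
      ((hZ i).sub (π.hasSum_toReal_one.mul_right (arr i / srv i))).mul_left (need i : ℝ)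
    simpa using this
  have h1 : Summable fun s => (π s).toReal
        * (∑ i, (need i : ℝ) * P.X s i - ∑ i, (need i : ℝ) * P.Z s i) := by
    have := summable_sum (s := Finset.univ) fun i _ =>
      ((hX i).sub (hZ i).summable).mul_left (need i : ℝ)
    refine this.congr fun s => ?_
    rw [← Finset.sum_sub_distrib, Finset.mul_sum]
    exact Finset.sum_congr rfl fun i _ => by ring
  have h2 := h1.hasSum.add h0
  rw [add_zero] at h2
  refine h2.congr_fun fun s => ?_
  rw [excessNeed, ← Finset.sum_sub_distrib, Finset.mul_sum, Finset.mul_sum,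
    ← Finset.sum_add_distrib]
  exact Finset.sum_congr rfl fun i _ => by ring

end Policy

/-! ### The bound at fixed `n` -/

namespace Policy

variable {I n : ℕ} {need : Fin I → ℕ} {P : Policy I n need} {arr srv : Fin I → ℝ}
  {π : PMF P.State}

theorem sum_need_Z_le (s : P.State) : ∑ i, (need i : ℝ) * P.Z s i ≤ n := by
  exact_mod_cast P.capacity s

/-- A drift inequality for the transitions of the queue bounds the stationary mean. -/
theorem IsStationary.tsum_ofReal_le_of_drift (hπ : P.IsStationary arr srv π)
    (hneed : ∀ i, 0 < need i) (harr : ∀ i, 0 ≤ arr i) (hsrv : ∀ i, 0 ≤ srv i)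
    {v : (Fin I → ℕ) → ℝ} (hv : ∀ x, 0 ≤ v x) {a b : ℝ} (ha : 0 < a)
    (hdrift : ∀ s, ∑ i, arr i * v (P.X s + Pi.single i 1)
      + ∑ i, srv i * P.Z s i * v (P.X s - Pi.single i 1) + a * v (P.X s)
      ≤ (∑ i, arr i + ∑ i, srv i * P.Z s i) * v (P.X s) + b) :
    ∑' s, π s * ENNReal.ofReal (v (P.X s)) ≤ ENNReal.ofReal (b / a) := by
  obtain ⟨B, hB, hrB⟩ := P.exists_rate_bound arr srv hneed
  have key := mul_tsum_le_of_drift (a := ENNReal.ofReal a) (b := ENNReal.ofReal b)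
    (v := fun s => ENNReal.ofReal (v (P.X s))) hπ hB hrB (fun s => ENNReal.ofReal_ne_top)
    (fun s => ?_)
  · rw [ENNReal.ofReal_div_of_pos ha, ENNReal.le_div_iff_mul_le
      (Or.inl (ENNReal.ofReal_pos.2 ha).ne') (Or.inl ENNReal.ofReal_ne_top), mul_comm]
    exact key
  · rw [P.tsum_rate_mul arr srv (fun x => ENNReal.ofReal (v x)) s, tsum_rate, add_mul,
      add_right_comm, add_right_comm (_ * _)]
    refine add_le_add_left ?_ _
    have hz : ∀ i, 0 ≤ srv i * P.Z s i := fun i => mul_nonneg (hsrv i) (Nat.cast_nonneg _)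
    have hsz : ∀ i, ENNReal.ofReal (srv i) * (P.Z s i : ℝ≥0∞)
        = ENNReal.ofReal (srv i * P.Z s i) := fun i => by
      rw [ENNReal.ofReal_mul (hsrv i), ENNReal.ofReal_natCast]
    simp_rw [hsz, ← ENNReal.ofReal_mul (harr _), ← ENNReal.ofReal_mul (hz _),
      ← ENNReal.ofReal_mul ha.le]
    rw [← ENNReal.ofReal_sum_of_nonneg fun i _ => mul_nonneg (harr i) (hv _),
      ← ENNReal.ofReal_sum_of_nonneg fun i _ => mul_nonneg (hz i) (hv _),
      ← ENNReal.ofReal_sum_of_nonneg fun i _ => harr i,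
      ← ENNReal.ofReal_sum_of_nonneg fun i _ => hz i,
      ← ENNReal.ofReal_add (Finset.sum_nonneg fun i _ => harr i)
        (Finset.sum_nonneg fun i _ => hz i),
      ← ENNReal.ofReal_mul (add_nonneg (Finset.sum_nonneg fun i _ => harr i)
        (Finset.sum_nonneg fun i _ => hz i)),
      ← ENNReal.ofReal_add (Finset.sum_nonneg fun i _ => mul_nonneg (harr i) (hv _))
        (Finset.sum_nonneg fun i _ => mul_nonneg (hz i) (hv _)),
      ← ENNReal.ofReal_add (add_nonneg (Finset.sum_nonneg fun i _ => mul_nonneg (harr i) (hv _))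
        (Finset.sum_nonneg fun i _ => mul_nonneg (hz i) (hv _))) (mul_nonneg ha.le (hv _))]
    exact (ENNReal.ofReal_le_ofReal (hdrift s)).trans ENNReal.ofReal_add_le

/-- A nonasymptotic bound on the mean excess server need. -/
theorem IsStationary.expectedExcessNeed_bounds (hπ : P.IsStationary arr srv π)
    (hI : 0 < I) (hneed : ∀ i, 0 < need i) (harr : ∀ i, 0 < arr i) (hsrv : ∀ i, 0 < srv i)
    {m M w θ r L δ K β : ℝ} (hw : 0 < w) (hm0 : 0 ≤ m) (hm : ∀ i, m ≤ srv i)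
    (hM0 : 0 < M) (hM : ∀ i, srv i ≤ M)
    (hθ : 0 < θ) (hθr : ∀ i, θ * ((need i : ℝ) / srv i) ≤ r) (hr0 : 0 ≤ r) (hr : r ≤ 1)
    (hδ : 0 < δ) (hK : 0 < K) (hload : ∑ i, arr i * (need i : ℝ) / srv i = n - δ)
    (hKL : K * δ ≤ δ - L) (hwK : w * ∑ i, (need i : ℝ) ≤ K * δ) (hβ : 2 * K ≤ m * β)
    (hsmall : 2 * (n : ℝ) * (1 / w + r) ≤ K * δ / 2) (hβL : M * (4 * (β * δ)) ≤ δ - L)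
    (hwc : P.WorkConserving L) :
    Summable (fun s => (π s).toReal * P.excessNeed arr srv s) ∧
      0 < P.expectedExcessNeed arr srv π ∧
      P.expectedExcessNeed arr srv π ≤ 8 * M / θ * Real.exp (-(θ * (β * δ))) := by
  set F : P.State → ℝ := fun s => softWork arr srv need w (P.X s) with hF
  have hF0 : ∀ s, 0 ≤ F s := fun s => softWork_nonneg hw hsrv _
  set Q : P.State → ℝ := fun s =>
    ∑ i, (need i : ℝ) * P.X s i - ∑ i, (need i : ℝ) * P.Z s i with hQ
  have hQ0 : ∀ s, 0 ≤ Q s := fun s => sub_nonneg.2 <| Finset.sum_le_sum fun i _ =>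
    mul_le_mul_of_nonneg_left (Nat.cast_le.2 (P.Z_le_X s i)) (Nat.cast_nonneg _)
  have hmean := hπ.tsum_ofReal_le_of_drift hneed (fun i => (harr i).le) (fun i => (hsrv i).le)
    (v := fun x => Real.exp (θ * softWork arr srv need w x)) (fun _ => (Real.exp_pos _).le)
    (a := θ * (K * δ / 2)) (by positivity)
    (fun s => exp_softWork_drift hw (fun i => (harr i).le) hsrv hneed hm0 hm hθ.le hθr hr0 hr
      hδ.le hK.le hload hKL hwK hβ hsmall (P.Z_le_X s) (sum_need_Z_le s) (hwc s))
  have hratio : θ * (2 * (K * δ)) * Real.exp (θ * (β * δ)) / (θ * (K * δ / 2))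
      = 4 * Real.exp (θ * (β * δ)) := by field_simp; ring
  rw [hratio] at hmean
  obtain ⟨hVs, hVle⟩ := π.summable_and_tsum_le_of_tsum_ofReal_le
    (g := fun s => Real.exp (θ * F s)) (fun _ => (Real.exp_pos _).le) (by positivity) hmean
  have hπ0 : ∀ s, 0 ≤ (π s).toReal := fun s => ENNReal.toReal_nonneg
  -- Each `X_i` is at most `M F + n`, which the integrable `exp (θ F)` dominates up to a constant.
  have hXs : ∀ i, Summable fun s => (π s).toReal * (P.X s i : ℝ) := by
    intro i
    refine Summable.of_nonneg_of_le (fun s => mul_nonneg (hπ0 s) (Nat.cast_nonneg _))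
      (fun s => ?_) (hVs.mul_left (M / θ + n))
    rw [mul_left_comm]
    refine mul_le_mul_of_nonneg_left ?_ (hπ0 s)
    have h1 := sum_need_sub_le_softWork (arr := arr) (need := need) hw hsrv hM (P.X s)
    have h2 : ∑ i, (need i : ℝ) * ((P.X s i : ℝ) - arr i / srv i)
        = ∑ i, (need i : ℝ) * P.X s i - ∑ i, arr i * (need i : ℝ) / srv i := by
      rw [← Finset.sum_sub_distrib]
      exact Finset.sum_congr rfl fun i _ => by ring
    have h3 : (P.X s i : ℝ) ≤ ∑ i, (need i : ℝ) * P.X s i :=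
      calc (P.X s i : ℝ) ≤ need i * P.X s i :=
            le_mul_of_one_le_left (Nat.cast_nonneg _) (Nat.one_le_cast.2 (hneed i))
        _ ≤ _ := Finset.single_le_sum (f := fun i => (need i : ℝ) * P.X s i)
            (fun _ _ => by positivity) (Finset.mem_univ i)
    have h4 : M * F s ≤ M / θ * Real.exp (θ * F s) := by
      have := Real.add_one_le_exp (θ * F s)
      calc M * F s = M / θ * (θ * F s) := by field_simp
        _ ≤ _ := mul_le_mul_of_nonneg_left (by linarith) (by positivity)
    have h5 : (n : ℝ) ≤ n * Real.exp (θ * F s) :=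
      le_mul_of_one_le_right (Nat.cast_nonneg _) (Real.one_le_exp (mul_nonneg hθ.le (hF0 s)))
    simp only [hF] at h4 h5 ⊢
    linarith
  have hQV : ∀ s, Q s ≤ 2 * M / θ * Real.exp (-(2 * (θ * (β * δ)))) * Real.exp (θ * F s) := by
    intro s
    rcases (hQ0 s).eq_or_lt with h | h
    · rw [← h]; positivity
    have hle := le_softWork_of_waiting hw hsrv hM hload (hwc s) (sub_pos.1 h)
    have hKδ : 0 < K * δ := mul_pos hK hδ
    have hQF : Q s ≤ M * F s := by simp only [hQ, hF]; linarith
    have hFβ : 4 * (β * δ) ≤ F s := by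
      refine le_of_mul_le_mul_left ?_ hM0
      simp only [hQ, hF] at h ⊢
      linarith
    calc Q s ≤ M * F s := hQF
      _ = 2 * M / θ * (θ * F s / 2) := by field_simp
      _ ≤ 2 * M / θ * Real.exp (θ * F s / 2) :=
        mul_le_mul_of_nonneg_left (by linarith [Real.add_one_le_exp (θ * F s / 2)])
          (by positivity)
      _ ≤ 2 * M / θ * Real.exp (-(2 * (θ * (β * δ))) + θ * F s) :=
        mul_le_mul_of_nonneg_left
          (Real.exp_le_exp.2 (by linarith [mul_le_mul_of_nonneg_left hFβ hθ.le]))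
          (by positivity)
      _ = _ := by rw [Real.exp_add, mul_assoc]
  have hQterm : ∀ s, (π s).toReal * Q s ≤ 2 * M / θ * Real.exp (-(2 * (θ * (β * δ))))
      * ((π s).toReal * Real.exp (θ * F s)) := fun s => by
    rw [mul_left_comm]
    exact mul_le_mul_of_nonneg_left (hQV s) (hπ0 s)
  have hQs : Summable fun s => (π s).toReal * Q s :=
    Summable.of_nonneg_of_le (fun s => mul_nonneg (hπ0 s) (hQ0 s)) hQterm (hVs.mul_left _)
  have hsum := hπ.hasSum_excessNeed hneed (fun i => (harr i).le) hsrv hXs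
  have hEq : P.expectedExcessNeed arr srv π = ∑' s, (π s).toReal * Q s := hsum.tsum_eq
  refine ⟨hsum.summable, ?_, ?_⟩
  · obtain ⟨s, hs, hX⟩ := hπ.exists_le_X (harr ⟨0, hI⟩) (n + 1)
    rw [hEq]
    refine hQs.tsum_pos (fun s => mul_nonneg (hπ0 s) (hQ0 s)) s
      (mul_pos (ENNReal.toReal_pos hs (π.apply_ne_top s)) (sub_pos.2 ?_))
    calc ∑ i, (need i : ℝ) * P.Z s i ≤ n := sum_need_Z_le s
      _ < P.X s ⟨0, hI⟩ := Nat.cast_lt.2 hX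
      _ ≤ need ⟨0, hI⟩ * P.X s ⟨0, hI⟩ :=
        le_mul_of_one_le_left (Nat.cast_nonneg _) (Nat.one_le_cast.2 (hneed _))
      _ ≤ _ := Finset.single_le_sum (f := fun i => (need i : ℝ) * P.X s i)
            (fun _ _ => by positivity) (Finset.mem_univ _)
  · rw [hEq]
    calc ∑' s, (π s).toReal * Q s
        ≤ 2 * M / θ * Real.exp (-(2 * (θ * (β * δ))))
          * ∑' s, (π s).toReal * Real.exp (θ * F s) := by
          rw [← tsum_mul_left]
          exact hQs.tsum_le_tsum hQterm (hVs.mul_left _)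
      _ ≤ 2 * M / θ * Real.exp (-(2 * (θ * (β * δ)))) * (4 * Real.exp (θ * (β * δ))) :=
          mul_le_mul_of_nonneg_left hVle (by positivity)
      _ = 8 * M / θ * (Real.exp (-(2 * (θ * (β * δ)))) * Real.exp (θ * (β * δ))) := by ring
      _ = _ := by rw [← Real.exp_add]; congr 2; ring

end Policy

/-! ### Choice of parameters and asymptotics -/

theorem eventually_mul_pow_le_exp_mul_log_sq (A : ℝ) (k : ℕ) {c : ℝ} (hc : 0 < c) :
    ∀ᶠ n : ℕ in atTop, A * (n : ℝ) ^ k ≤ Real.exp (c * Real.log n ^ 2) := by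
  have hlog : Tendsto (fun n : ℕ => Real.log n) atTop atTop :=
    Real.tendsto_log_atTop.comp tendsto_natCast_atTop_atTop
  have h : ∀ᶠ n : ℕ in atTop, (|A| + k) / c + 1 ≤ Real.log n := hlog.eventually_ge_atTop _
  filter_upwards [h, eventually_gt_atTop 0] with n hn hn0
  have hn' : (0 : ℝ) < n := Nat.cast_pos.2 hn0
  set t := Real.log n with ht
  have ht1 : 1 ≤ t := le_trans (le_add_of_nonneg_left (by positivity)) hn
  have hct : |A| + k ≤ c * t := by
    have : (|A| + k) / c ≤ t := by linarith
    rwa [div_le_iff₀ hc, mul_comm] at this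
  have hpow : (n : ℝ) ^ k = Real.exp (k * t) := by
    rw [mul_comm, ht, Real.exp_mul, Real.exp_log hn', Real.rpow_natCast]
  calc A * (n : ℝ) ^ k ≤ Real.exp |A| * Real.exp (k * t) := by
        rw [hpow]
        refine mul_le_mul_of_nonneg_right ?_ (Real.exp_pos _).le
        linarith [le_abs_self A, Real.add_one_le_exp |A|]
    _ = Real.exp (|A| + k * t) := by rw [Real.exp_add]
    _ ≤ _ := Real.exp_le_exp.2 (by nlinarith [abs_nonneg A])

/-- The mean excess server need under the conditions of the light-traffic regime, at fixed `n`. -/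
theorem Policy.IsStationary.expectedExcessNeed_bounds_of_slack {I n : ℕ} {need : Fin I → ℕ}
    {P : Policy I n need} {arr srv : Fin I → ℝ} {π : PMF P.State}
    (hπ : P.IsStationary arr srv π) (hwc : P.WorkConserving (maxNeed need))
    (hI : 0 < I) (hneed : ∀ i, 0 < need i) (harr : ∀ i, 0 < arr i)
    {ε₀ m M : ℝ} (hε₀ : 0 < ε₀) (hε₀' : ε₀ < 1) (hm0 : 0 < m) (hm : ∀ i, m ≤ srv i)
    (hM : ∀ i, srv i ≤ M) (hn : 0 < n)
    (hδ : (maxNeed need : ℝ) ≤ ε₀ * slack n arr srv need)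
    {K : ℝ} (hK : K = m * (1 - ε₀) / (8 * M))
    (hlarge : 8 * I / K ^ 2 ≤ slack n arr srv need ^ 2 / (n * maxNeed need)) :
    Summable (fun s => (π s).toReal * P.excessNeed arr srv s) ∧
      0 < P.expectedExcessNeed arr srv π ∧
      P.expectedExcessNeed arr srv π ≤ 64 * M / (K * m) * n
        * Real.exp (-(K ^ 2 / 4 * (slack n arr srv need ^ 2 / (n * maxNeed need)))) := by
  set δ := slack n arr srv need with hδdef
  set L : ℝ := (maxNeed need : ℝ) with hL
  have hsrv : ∀ i, 0 < srv i := fun i => hm0.trans_le (hm i)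
  have hmM : m ≤ M := (hm ⟨0, hI⟩).trans (hM _)
  have hM0 : 0 < M := hm0.trans_le hmM
  have he : 0 < 1 - ε₀ := by linarith
  have hK0 : 0 < K := by rw [hK]; positivity
  have hK1 : 8 * K ≤ 1 - ε₀ := by
    rw [hK, mul_div_assoc', div_le_iff₀ (by positivity)]
    nlinarith
  have hneedL : ∀ i, (need i : ℝ) ≤ L := fun i =>
    Nat.cast_le.2 (Finset.le_sup (f := need) (Finset.mem_univ i))
  have hL1 : 1 ≤ L := le_trans (Nat.one_le_cast.2 (hneed ⟨0, hI⟩)) (hneedL _)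
  -- Positivity of the slack follows from `1 ≤ L ≤ ε₀ δ`.
  have hδ0 : 0 < δ := by
    by_contra h
    nlinarith
  have hLδ : L ≤ δ := hδ.trans (mul_le_of_le_one_left hδ0.le hε₀'.le)
  have hload : ∑ i, arr i * (need i : ℝ) / srv i = n - δ := by rw [hδdef, slack]; ring
  have hδn : δ ≤ n := by
    have : 0 ≤ ∑ i, arr i * (need i : ℝ) / srv i := Finset.sum_nonneg fun i _ =>
      div_nonneg (mul_nonneg (harr i).le (Nat.cast_nonneg _)) (hsrv i).le
    linarith
  have hn0 : (0 : ℝ) < n := Nat.cast_pos.2 hn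
  have hI0 : (0 : ℝ) < I := Nat.cast_pos.2 hI
  have hL0 : 0 < L := by linarith
  have hβK : m * ((1 - ε₀) / (4 * M)) = 2 * K := by rw [hK]; field_simp; ring
  have hmβ : (1 - ε₀) / (4 * M) = 2 * K / m := by rw [← hβK]; field_simp
  have hsmallr : K * δ / (8 * n) ≤ K / 8 := by
    rw [div_le_div_iff₀ (by positivity) (by norm_num)]
    nlinarith
  -- `w` makes the smoothing cost at most `K δ`; `r` makes `2 n r = K δ / 4`, and `hlarge` bounds `2
  -- n / w` by the same amount. Then `θ = r m / L`, as `ℓ_i / μ_i ≤ L / m`. `β` gives `4 M β δ = (1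
  -- - ε₀) δ ≤ δ - L`, and `K` is fixed by `m β = 2 K`.
  have hbounds := hπ.expectedExcessNeed_bounds hI hneed harr hsrv (m := m) (M := M)
    (w := K / I * δ / L) (θ := K * δ * m / (8 * (n * L))) (r := K * δ / (8 * n)) (L := L) (δ := δ)
    (K := K) (β := (1 - ε₀) / (4 * M)) (by positivity) hm0.le hm hM0 hM (by positivity)
    (fun i => ?_) (by positivity) (by linarith) hδ0 hK0 hload (by nlinarith) ?_ hβK.ge ?_ ?_ hwc
  · refine ⟨hbounds.1, hbounds.2.1, hbounds.2.2.trans ?_⟩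
    have hexp : K * δ * m / (8 * (n * L)) * ((1 - ε₀) / (4 * M) * δ)
        = K ^ 2 / 4 * (δ ^ 2 / (n * L)) := by rw [hmβ]; field_simp; ring
    rw [hexp]
    refine mul_le_mul_of_nonneg_right ?_ (Real.exp_pos _).le
    calc 8 * M / (K * δ * m / (8 * (n * L))) = 64 * M / (K * m) * n * (L / δ) := by
          field_simp; ring
      _ ≤ 64 * M / (K * m) * n * 1 :=
          mul_le_mul_of_nonneg_left ((div_le_one hδ0).2 hLδ) (by positivity)
      _ = _ := mul_one _
  · calc K * δ * m / (8 * (n * L)) * ((need i : ℝ) / srv i)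
        ≤ K * δ * m / (8 * (n * L)) * (L / m) :=
          mul_le_mul_of_nonneg_left (div_le_div₀ hL0.le (hneedL i) hm0 (hm i)) (by positivity)
      _ = K * δ / (8 * n) := by field_simp
  · calc K / I * δ / L * ∑ i, (need i : ℝ) ≤ K / I * δ / L * (I * L) := by
          refine mul_le_mul_of_nonneg_left ?_ (by positivity)
          simpa using Finset.sum_le_card_nsmul Finset.univ (fun i => (need i : ℝ)) L
            fun i _ => hneedL i
      _ = K * δ := by field_simp
  · have h1 : 2 * (n : ℝ) * (1 / (K / I * δ / L)) ≤ K * δ / 4 := by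
      rw [div_le_div_iff₀ (by positivity) (by positivity)] at hlarge
      have : 2 * (n : ℝ) * (1 / (K / I * δ / L)) = 2 * I * (n * L) / (K * δ) := by
        field_simp
      rw [this, div_le_div_iff₀ (by positivity) (by norm_num)]
      nlinarith
    have h2 : 2 * (n : ℝ) * (K * δ / (8 * n)) = K * δ / 4 := by field_simp; ring
    rw [mul_add]
    linarith
  · have : M * (4 * ((1 - ε₀) / (4 * M) * δ)) = (1 - ε₀) * δ := by field_simp
    linarith

theorem log_sq_le_slack_ratio {N L δ t : ℝ} (hN : 0 < N) (hL : 0 < L) (ht : 0 ≤ t)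
    (h : √(N * L) * t ≤ |δ|) : t ^ 2 ≤ δ ^ 2 / (N * L) := by
  rw [le_div_iff₀ (by positivity)]
  have := pow_le_pow_left₀ (by positivity) h 2
  rw [mul_pow, Real.sq_sqrt (by positivity), sq_abs] at this
  linarith

end MultiserverJob

theorem lemma6 (I : ℕ) (hI : 0 < I) (srv : Fin I → ℝ) (hsrv : ∀ i, 0 < srv i)
    (ε₀ : ℝ) (hε₀ : 0 < ε₀) (hε₀' : ε₀ < 1) :
    ∃ c : ℝ, 0 < c ∧
      ∀ (arr : ℕ → Fin I → ℝ) (need : ℕ → Fin I → ℕ),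
        (∀ n i, 0 < arr n i) →
        (∀ n i, 0 < need n i) →
        (∀ᶠ n in atTop, (MultiserverJob.maxNeed (need n) : ℝ)
          ≤ ε₀ * MultiserverJob.slack n (arr n) srv (need n)) →
        ((fun n : ℕ => √((n : ℝ) * (MultiserverJob.maxNeed (need n) : ℝ)) * Real.log n)
          =o[atTop] fun n : ℕ => MultiserverJob.slack n (arr n) srv (need n)) →
        (∀ᶠ n in atTop,
          ∀ (P : MultiserverJob.Policy I n (need n)) (π : PMF P.State),
            P.WorkConserving (MultiserverJob.maxNeed (need n)) →
            P.IsStationary (arr n) srv π →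
            Summable (fun s => (π s).toReal * P.excessNeed (arr n) srv s) ∧
            0 < P.expectedExcessNeed (arr n) srv π ∧
            P.expectedExcessNeed (arr n) srv π ≤
              Real.exp (-(c * (MultiserverJob.slack n (arr n) srv (need n) ^ 2
                / ((n : ℝ) * (MultiserverJob.maxNeed (need n) : ℝ)))))) ∧
        (∀ (k : ℕ) (ε : ℝ), 0 < ε → ∀ᶠ n in atTop,
          ∀ (P : MultiserverJob.Policy I n (need n)) (π : PMF P.State),
            P.WorkConserving (MultiserverJob.maxNeed (need n)) →
            P.IsStationary (arr n) srv π →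
            (n : ℝ) ^ k * P.expectedExcessNeed (arr n) srv π ≤ ε) := by
  open MultiserverJob in
  have : Nonempty (Fin I) := ⟨⟨0, hI⟩⟩
  obtain ⟨i₀, hi₀⟩ := Finite.exists_min srv
  obtain ⟨i₁, hi₁⟩ := Finite.exists_max srv
  set m := srv i₀
  set M := srv i₁
  have hm0 : 0 < m := hsrv i₀
  have hM0 : 0 < M := hsrv i₁
  have he : 0 < 1 - ε₀ := by linarith
  set K := m * (1 - ε₀) / (8 * M) with hK
  have hK0 : 0 < K := by positivity
  -- Half of the exponent `K ^ 2 / 4` at fixed `n`; the other half absorbs the prefactor linear in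
  -- `n`.
  refine ⟨K ^ 2 / 8, by positivity, fun arr need harr hneed hslack hlittle => ?_⟩
  have hratio : ∀ᶠ n : ℕ in atTop, Real.log n ^ 2 ≤ slack n (arr n) srv (need n) ^ 2
      / ((n : ℝ) * (maxNeed (need n) : ℝ)) := by
    -- Constant `1` in the little-o suffices, since `exp (c * log² n)` beats every power of `n` for
    -- any `c > 0`.
    filter_upwards [hlittle.bound one_pos, eventually_gt_atTop 0] with n hb hn
    have hlog : 0 ≤ Real.log n := Real.log_natCast_nonneg n
    rw [one_mul, Real.norm_eq_abs, Real.norm_eq_abs,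
      abs_of_nonneg (mul_nonneg (Real.sqrt_nonneg _) hlog)] at hb
    have hL : 0 < maxNeed (need n) :=
      (hneed n i₀).trans_le (Finset.le_sup (f := need n) (Finset.mem_univ i₀))
    exact log_sq_le_slack_ratio (Nat.cast_pos.2 hn) (Nat.cast_pos.2 hL) hlog hb
  have hlogtop : Tendsto (fun n : ℕ => Real.log n ^ 2) atTop atTop :=
    (tendsto_pow_atTop two_ne_zero).comp
      (Real.tendsto_log_atTop.comp tendsto_natCast_atTop_atTop)
  have hfirst : ∀ᶠ n in atTop,
      ∀ (P : Policy I n (need n)) (π : PMF P.State),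
        P.WorkConserving (maxNeed (need n)) → P.IsStationary (arr n) srv π →
        Summable (fun s => (π s).toReal * P.excessNeed (arr n) srv s) ∧
        0 < P.expectedExcessNeed (arr n) srv π ∧
        P.expectedExcessNeed (arr n) srv π ≤
          Real.exp (-(K ^ 2 / 8 * (slack n (arr n) srv (need n) ^ 2
            / ((n : ℝ) * (maxNeed (need n) : ℝ))))) := by
    filter_upwards [hslack, hratio, hlogtop.eventually_ge_atTop (8 * I / K ^ 2),
      eventually_gt_atTop 0, eventually_mul_pow_le_exp_mul_log_sq (64 * M / (K * m)) 1
        (by positivity : 0 < K ^ 2 / 8)] with n hδ hq hlarge hn hpoly P π hwc hπ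
    obtain ⟨h1, h2, h3⟩ := hπ.expectedExcessNeed_bounds_of_slack hwc hI (hneed n) (harr n)
      hε₀ hε₀' hm0 hi₀ hi₁ hn hδ hK (hlarge.trans hq)
    refine ⟨h1, h2, h3.trans ?_⟩
    set q := slack n (arr n) srv (need n) ^ 2 / ((n : ℝ) * (maxNeed (need n) : ℝ))
    rw [pow_one] at hpoly
    calc _ ≤ Real.exp (K ^ 2 / 8 * q) * Real.exp (-(K ^ 2 / 4 * q)) := by
          refine mul_le_mul_of_nonneg_right (hpoly.trans (Real.exp_le_exp.2 ?_))
            (Real.exp_pos _).le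
          exact mul_le_mul_of_nonneg_left hq (by positivity)
      _ = _ := by rw [← Real.exp_add]; congr 1; ring
  refine ⟨hfirst, fun k ε hε => ?_⟩
  filter_upwards [hfirst, hratio, eventually_mul_pow_le_exp_mul_log_sq ε⁻¹ k
    (by positivity : 0 < K ^ 2 / 8)] with n hn hq hpoly P π hwc hπ
  obtain ⟨-, -, h3⟩ := hn P π hwc hπ
  set q := slack n (arr n) srv (need n) ^ 2 / ((n : ℝ) * (maxNeed (need n) : ℝ))
  have h4 : (n : ℝ) ^ k ≤ ε * Real.exp (K ^ 2 / 8 * q) := by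
    rw [inv_mul_le_iff₀ hε] at hpoly
    exact hpoly.trans (mul_le_mul_of_nonneg_left
      (Real.exp_le_exp.2 (mul_le_mul_of_nonneg_left hq (by positivity))) hε.le)
  calc (n : ℝ) ^ k * P.expectedExcessNeed (arr n) srv π
      ≤ ε * Real.exp (K ^ 2 / 8 * q) * Real.exp (-(K ^ 2 / 8 * q)) :=
        mul_le_mul h4 h3 (hn P π hwc hπ).2.1.le (by positivity)
    _ = ε := by rw [mul_assoc, ← Real.exp_add, add_neg_cancel, Real.exp_zero, mul_one]
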